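/- Let $\mathcal H$ be a complex Hilbert space with an orthonormal basis $(e_n)_{n\in\mathbb Z}$, and let $S$ be a bounded bilateral weighted shift on $\mathcal H$: $Se_n=\omega_n e_{n+1}$ for all $n\in\mathbb Z$, where $(\omega_n)_{n\in\mathbb Z}$ is a bounded sequence of positive numbers. Put $\beta_0=1$, $\beta_n=\omega_0\cdots\omega_{n-1}$ for $n>0$ and $\beta_n=\frac{1}{\omega_n\cdots\omega_{-1}}$ for $n<0$, and let $$r_2^-(S)=\liminf_{n\to+\infty}\Big[\frac1{\beta_{-n}}\Big]^{1/n},\qquad r_3^+(S)=\limsup_{n\to+\infty}[\beta_n]^{1/n},\qquad r_1(S)=\sup_{n\ge1}[m(S^n)]^{1/n},$$ where $m(T)=\inf\{\|Tx\|:\|x\|=1\}$; let $r(T)$ denote the spectral radius of $T$. For a bounded operator $T$ on $\mathcal H$ and $x\in\mathcal H$, let $\sigma_T(x)$ be the complement in $\mathbb C$ of the union of all open sets $U\subset\mathbb C$ for which there is an analytic function $f:U\to\mathcal H$ with $(T-\lambda)f(\lambda)=x$ for all $\lambda\in U$. The operator $T$ satisfies Dunford's condition (C) if $\{x\in\mathcal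 H:\sigma_T(x)\subset F\}$ is closed in $\mathcal H$ for every closed set $F\subset\mathbb C$. Assume that $S$ satisfies Dunford's condition (C). (a) If $S$ is not invertible, then $r_1(S)=r_2^-(S)=0\le r_3^+(S)=r(S)$. (b) If $S$ is invertible, then $r_1(S)=\dfrac{1}{r(S^{-1})}=r_2^-(S)\le r_3^+(S)=r(S)$. -/

import Mathlib

open scoped ENNReal

noncomputable section

variable {H : Type*} [NormedAddCommGroup H] [InnerProductSpace ℂ H]

/-- The local resolvent set of `T` at `x`: the union of all open `U ⊆ ℂ` on which there is an
analytic `H`-valued function `f` with `(T - μ) f(μ) = x` for all `μ ∈ U`. -/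
def localResolventSet (T : H →L[ℂ] H) (x : H) : Set ℂ :=
  ⋃₀ {U : Set ℂ | IsOpen U ∧ ∃ f : ℂ → H, AnalyticOnNhd ℂ f U ∧
    ∀ μ ∈ U, (T - μ • ContinuousLinearMap.id ℂ H) (f μ) = x}

/-- The local spectrum of `T` at `x`. -/
def localSpectrum (T : H →L[ℂ] H) (x : H) : Set ℂ :=
  (localResolventSet T x)ᶜ

/-- The analytic spectral subspace of `T` associated with `F`. -/
def analyticSpectralSubspace (T : H →L[ℂ] H) (F : Set ℂ) : Set H :=
  {x : H | localSpectrum T x ⊆ F}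

/-- Dunford's condition (C): all analytic spectral subspaces of closed sets are closed. -/
def DunfordConditionC (T : H →L[ℂ] H) : Prop :=
  ∀ F : Set ℂ, IsClosed F → IsClosed (analyticSpectralSubspace T F)

/-- The lower bound `m(T) = inf {‖T x‖ : ‖x‖ = 1}`. -/
def lowerBound (T : H →L[ℂ] H) : ℝ≥0∞ :=
  ⨅ (x : H) (_ : ‖x‖ = 1), ‖T x‖ₑ

/-- `r₁(T) = sup_{n ≥ 1} m(Tⁿ)^{1/n}`. -/
def rOne (T : H →L[ℂ] H) : ℝ≥0∞ :=
  ⨆ (n : ℕ) (_ : 1 ≤ n), lowerBound (T ^ n) ^ (1 / (n : ℝ))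

/-- `S` is the bilateral weighted shift with positive weights `ω` relative to the orthonormal
(Hilbert) basis `e`. The weights are automatically bounded, since `S` is. -/
structure IsBilateralWeightedShift (e : HilbertBasis ℤ ℂ H) (ω : ℤ → ℝ) (S : H →L[ℂ] H) :
    Prop where
  weight_pos : ∀ n, 0 < ω n
  apply_basis : ∀ n, S (e n) = (ω n : ℂ) • e (n + 1)

/-- `β n = ω 0 ⋯ ω (n-1)` for `n ≥ 0` and `β n = 1 / (ω n ⋯ ω (-1))` for `n < 0`. -/
def shiftBeta (ω : ℤ → ℝ) (n : ℤ) : ℝ :=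
  if 0 ≤ n then ∏ k ∈ Finset.Ico 0 n, ω k else 1 / ∏ k ∈ Finset.Ico n 0, ω k

/-- `r₂⁻ = liminf (1 / β (-n))^{1/n}`. -/
def rTwoMinus (ω : ℤ → ℝ) : ℝ≥0∞ :=
  Filter.liminf
    (fun n : ℕ => ENNReal.ofReal ((1 / shiftBeta ω (-(n : ℤ))) ^ (1 / (n : ℝ)))) Filter.atTop

/-- `r₃⁺ = limsup (β n)^{1/n}`. -/
def rThreePlus (ω : ℤ → ℝ) : ℝ≥0∞ :=
  Filter.limsup
    (fun n : ℕ => ENNReal.ofReal (shiftBeta ω (n : ℤ) ^ (1 / (n : ℝ)))) Filter.atTop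

end

open Filter Topology

/-! ### Local resolvents and condition (C) -/

section LocalSpectralTheory

variable {H : Type*} [NormedAddCommGroup H] [InnerProductSpace ℂ H]

/-! With `v k = β k • e k` the shift becomes `S (v k) = v (k + 1)`, so `(S - z) f = v k` is solved
by a Laurent series along the forward orbit for `|z| > r₃⁺`, and by a power series along the
backward orbit for `|z| < r₂⁻`. Condition (C) extends solvability from the basis to all of `H`: `S -
μ` is onto whenever `|μ| > r₃⁺` or `|μ| < r₂⁻`.

Surjectivity is enough to control spectral radii, because a surjective norm limit of invertible
operators is invertible; hence the spectral radius is attained at some `μ` with `T - μ` not onto.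
Applied to `S` this gives `r(S) ≤ r₃⁺`, and applied to `S⁻¹` it gives `r₂⁻ ≤ 1 / r(S⁻¹)`. The
reverse bounds come from testing `‖Sⁿ‖` and `‖S⁻ⁿ‖` on `e 0`. As `S` is always injective, `r₂⁻ > 0`
forces invertibility. Finally `r₁` follows from `m(Sⁿ) = 1 / ‖S⁻ⁿ‖` and Gelfand's formula, or
vanishes since `Sⁿ` has dense range. -/

theorem localResolventSet_inter_subset_add (T : H →L[ℂ] H) (x y : H) :
    localResolventSet T x ∩ localResolventSet T y ⊆ localResolventSet T (x + y) := by
  rintro μ ⟨⟨U, ⟨hU, f, hf, hfx⟩, hμU⟩, ⟨V, ⟨hV, g, hg, hgy⟩, hμV⟩⟩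
  refine ⟨U ∩ V, ⟨hU.inter hV, f + g, fun z hz => (hf z hz.1).add (hg z hz.2), ?_⟩, hμU, hμV⟩
  intro z hz
  rw [Pi.add_apply, map_add, hfx z hz.1, hgy z hz.2]

theorem localResolventSet_subset_smul (T : H →L[ℂ] H) (c : ℂ) (x : H) :
    localResolventSet T x ⊆ localResolventSet T (c • x) := by
  rintro μ ⟨U, ⟨hU, f, hf, hfx⟩, hμU⟩
  refine ⟨U, ⟨hU, c • f, fun z hz => (hf z hz).const_smul, ?_⟩, hμU⟩
  intro z hz
  rw [Pi.smul_apply, map_smul, hfx z hz]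

theorem localResolventSet_zero (T : H →L[ℂ] H) : localResolventSet T 0 = Set.univ :=
  Set.eq_univ_of_forall fun _ =>
    ⟨Set.univ, ⟨isOpen_univ, fun _ => 0, fun _ _ => analyticAt_const, by simp⟩, trivial⟩

theorem mem_analyticSpectralSubspace_iff {T : H →L[ℂ] H} {F : Set ℂ} {x : H} :
    x ∈ analyticSpectralSubspace T F ↔ Fᶜ ⊆ localResolventSet T x :=
  Set.compl_subset_comm

/-- The analytic spectral subspace as a linear subspace. -/
def analyticSpectralSubmodule (T : H →L[ℂ] H) (F : Set ℂ) : Submodule ℂ H where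
  carrier := analyticSpectralSubspace T F
  add_mem' {x y} hx hy := by
    rw [mem_analyticSpectralSubspace_iff] at *
    exact (Set.subset_inter hx hy).trans (localResolventSet_inter_subset_add T x y)
  zero_mem' := by
    rw [mem_analyticSpectralSubspace_iff, localResolventSet_zero]
    exact Set.subset_univ _
  smul_mem' c x hx := by
    rw [mem_analyticSpectralSubspace_iff] at *
    exact hx.trans (localResolventSet_subset_smul T c x)

theorem exists_sub_smul_eq_of_mem_localResolventSet {T : H →L[ℂ] H} {x : H} {μ : ℂ}
    (h : μ ∈ localResolventSet T x) : ∃ y, (T - μ • ContinuousLinearMap.id ℂ H) y = x := by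
  obtain ⟨U, ⟨-, f, -, hf⟩, hμ⟩ := h
  exact ⟨f μ, hf μ hμ⟩

/-- Under condition (C), if a total family lies in the spectral subspace of the closed set `F`,
then `T - μ` is onto for every `μ ∉ F`. -/
theorem DunfordConditionC.surjective_sub_smul {ι : Type*} {T : H →L[ℂ] H}
    (hT : DunfordConditionC T) {F : Set ℂ} (hF : IsClosed F) (e : HilbertBasis ι ℂ H)
    (he : ∀ i, e i ∈ analyticSpectralSubspace T F) {μ : ℂ} (hμ : μ ∉ F) :
    Function.Surjective (T - μ • ContinuousLinearMap.id ℂ H) := by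
  intro x
  have htop : (⊤ : Submodule ℂ H) ≤ analyticSpectralSubmodule T F := by
    rw [← e.dense_span]
    refine Submodule.topologicalClosure_minimal _ (Submodule.span_le.2 ?_) (hT F hF)
    rintro _ ⟨i, rfl⟩
    exact he i
  have hx : x ∈ analyticSpectralSubspace T F := htop trivial
  exact exists_sub_smul_eq_of_mem_localResolventSet (mem_analyticSpectralSubspace_iff.1 hx hμ)

variable [CompleteSpace H]

/-- The power series `∑ zⁿ v n` along a backward orbit telescopes under `T - z`. -/
theorem ball_subset_localResolventSet {T : H →L[ℂ] H} {x : H} {v : ℕ → H} {ρ : ℝ}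
    (h0 : T (v 0) = x) (hv : ∀ n, T (v (n + 1)) = v n)
    (hs : Summable fun n => ρ ^ n * ‖v n‖) :
    {z : ℂ | ‖z‖ < ρ} ⊆ localResolventSet T x := by
  have hU : IsOpen {z : ℂ | ‖z‖ < ρ} := isOpen_lt continuous_norm continuous_const
  have hle : ∀ n, ∀ z ∈ {z : ℂ | ‖z‖ < ρ}, ‖z ^ n • v n‖ ≤ ρ ^ n * ‖v n‖ := by
    intro n z hz
    rw [norm_smul, norm_pow]
    have : ‖z‖ ≤ ρ := le_of_lt hz
    gcongr
  refine Set.subset_sUnion_of_mem ⟨hU, fun z => ∑' n, z ^ n • v n, ?_, ?_⟩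
  · exact (Complex.differentiableOn_tsum_of_summable_norm hs (fun n => by fun_prop) hU hle).analyticOnNhd hU
  · intro z hz
    have hsum : Summable fun n => z ^ n • v n := .of_norm_bounded hs fun n => hle n z hz
    have hTsum : Summable fun n => T (z ^ n • v n) := hsum.mapL T
    have : T (∑' n, z ^ n • v n) = x + z • ∑' n, z ^ n • v n := by
      rw [T.map_tsum hsum, hTsum.tsum_eq_zero_add, ← tsum_const_smul'']
      simp [h0, hv, pow_succ', mul_smul]
    simp [this]

/-- The Neumann series `-∑ z⁻ⁿ⁻¹ v n` needs only growth control along one forward orbit, not on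
`‖Tⁿ‖`. -/
theorem exterior_subset_localResolventSet {T : H →L[ℂ] H} {v : ℕ → H} {ρ : ℝ} (hρ : 0 < ρ)
    (hv : ∀ n, T (v n) = v (n + 1)) (hs : Summable fun n => ρ⁻¹ ^ n * ‖v n‖) :
    {z : ℂ | ρ < ‖z‖} ⊆ localResolventSet T (v 0) := by
  have hU : IsOpen {z : ℂ | ρ < ‖z‖} := isOpen_lt continuous_const continuous_norm
  have hne : ∀ z ∈ {z : ℂ | ρ < ‖z‖}, z ≠ 0 := fun z hz => norm_pos_iff.1 (hρ.trans hz)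
  have hle : ∀ n, ∀ z ∈ {z : ℂ | ρ < ‖z‖}, ‖z⁻¹ ^ n • v n‖ ≤ ρ⁻¹ ^ n * ‖v n‖ := by
    intro n z hz
    rw [norm_smul, norm_pow, norm_inv]
    have : ρ ≤ ‖z‖ := le_of_lt hz
    gcongr
  have hd : ∀ n, DifferentiableOn ℂ (fun z : ℂ => z⁻¹ ^ n • v n) {z : ℂ | ρ < ‖z‖} := fun n =>
    ((differentiableOn_inv.mono hne).pow n).smul_const _
  refine Set.subset_sUnion_of_mem ⟨hU, fun z => -(z⁻¹ • ∑' n, z⁻¹ ^ n • v n), ?_, ?_⟩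
  · exact (((differentiableOn_inv.mono hne).smul
      (Complex.differentiableOn_tsum_of_summable_norm hs hd hU hle)).neg).analyticOnNhd hU
  · intro z hz
    have hz0 := hne z hz
    have hsum : Summable fun n => z⁻¹ ^ n • v n := .of_norm_bounded hs fun n => hle n z hz
    have h1 : ∑' n, z⁻¹ ^ n • v n = v 0 + z⁻¹ • T (∑' n, z⁻¹ ^ n • v n) := by
      rw [T.map_tsum hsum, ← tsum_const_smul'']
      conv_lhs => rw [hsum.tsum_eq_zero_add]
      simp [hv, pow_succ', mul_smul]
    have h2 : v 0 = (∑' n, z⁻¹ ^ n • v n) - z⁻¹ • T (∑' n, z⁻¹ ^ n • v n) :=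
      eq_sub_of_add_eq h1.symm
    rw [h2]
    simp [smul_smul, hz0]
    abel

end LocalSpectralTheory

/-! ### Surjectivity on the outer edge of the spectrum -/

section SpectralRadius

/-- The open mapping constant `C` of `A` bounds the inverses of the nearby `B n` uniformly by `2 *
C`, so a kernel vector `z` of `A` satisfies `‖z‖ ≤ 2 * C * ‖B n - A‖ * ‖z‖`, which tends to `0`. -/
theorem isUnit_of_surjective_of_tendsto {E : Type*} [NormedAddCommGroup E] [NormedSpace ℂ E]
    [CompleteSpace E] {A : E →L[ℂ] E} (hA : Function.Surjective A) {B : ℕ → E →L[ℂ] E}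
    (hB : Tendsto B atTop (𝓝 A)) (hu : ∀ n, IsUnit (B n)) : IsUnit A := by
  obtain ⟨C, hC, hCA⟩ := A.exists_preimage_norm_le hA
  refine ContinuousLinearMap.isUnit_iff_bijective.2 ⟨?_, hA⟩
  rw [injective_iff_map_eq_zero]
  intro z hz
  have hnorm : Tendsto (fun n => ‖B n - A‖) atTop (𝓝 0) := tendsto_iff_norm_sub_tendsto_zero.1 hB
  have hkey : ∀ᶠ n in atTop, ‖z‖ ≤ 2 * C * (‖B n - A‖ * ‖z‖) := by
    -- The threshold `1 / (2 * C)` leaves half of `‖D‖` to be absorbed in `hbound`.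
    filter_upwards [hnorm.eventually_le_const (show 0 < 1 / (2 * C) by positivity)] with n hn
    obtain ⟨u, hu⟩ := hu n
    set D : E →L[ℂ] E := ↑u⁻¹ with hD
    have hDB : ∀ x, D (B n x) = x := fun x => by
      rw [← hu, hD, ← mul_apply_eq_comp, Units.inv_mul, one_apply_eq_self]
    have hbound : ‖D‖ ≤ C + ‖D‖ / 2 := by
      refine D.opNorm_le_bound (by positivity) fun y => ?_
      obtain ⟨x, rfl, hx⟩ := hCA y
      have h1 : D (A x) = x - D ((B n - A) x) := by
        rw [sub_apply, map_sub, hDB]; abel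
      calc ‖D (A x)‖ ≤ ‖x‖ + ‖D ((B n - A) x)‖ := by rw [h1]; exact norm_sub_le _ _
        _ ≤ C * ‖A x‖ + ‖D‖ * (1 / (2 * C) * (C * ‖A x‖)) := by
          gcongr
          refine (D.le_opNorm _).trans ?_
          gcongr
          exact ((B n - A).le_opNorm x).trans (by gcongr)
        _ = (C + ‖D‖ / 2) * ‖A x‖ := by field_simp
    calc ‖z‖ = ‖D ((B n - A) z)‖ := by rw [sub_apply, hz, sub_zero, hDB]
      _ ≤ ‖D‖ * (‖B n - A‖ * ‖z‖) := (D.le_opNorm _).trans (by gcongr; exact (B n - A).le_opNorm z)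
      _ ≤ 2 * C * (‖B n - A‖ * ‖z‖) := by gcongr; linarith
  have hlim : Tendsto (fun n => 2 * C * (‖B n - A‖ * ‖z‖)) atTop (𝓝 0) := by
    simpa using (hnorm.mul_const ‖z‖).const_mul (2 * C)
  exact norm_le_zero_iff.1 (ge_of_tendsto hlim hkey)

/-- The spectral radius is attained at a point `μ` for which `T - μ` is not onto. -/
theorem exists_nnnorm_eq_spectralRadius_not_surjective {E : Type*} [NormedAddCommGroup E]
    [NormedSpace ℂ E] [CompleteSpace E] [Nontrivial E] (T : E →L[ℂ] E) :
    ∃ μ : ℂ, (‖μ‖₊ : ℝ≥0∞) = spectralRadius ℂ T ∧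
      ¬ Function.Surjective (T - μ • ContinuousLinearMap.id ℂ E) := by
  obtain ⟨μ, hμ, hr⟩ := spectrum.exists_nnnorm_eq_spectralRadius T
  -- Approach `μ` by resolvent points: dilating `μ` outward works unless `μ = 0`, where the spectrum
  -- is `{0}` and any nonzero scalars will do.
  by_cases h0 : μ = 0
  · subst h0
    have hzero : spectralRadius ℂ T = 0 := by rw [← hr]; simp
    refine ⟨0, hr, fun hs => hμ ?_⟩
    rw [spectrum.mem_resolventSet_iff, ← IsUnit.neg_iff, neg_sub]
    refine isUnit_of_surjective_of_tendsto (B := fun n => T - algebraMap ℂ (E →L[ℂ] E) (1 / ((n : ℂ) + 1)))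
      (by simpa using hs) ?_ fun n => ?_
    · refine tendsto_const_nhds.sub ?_
      exact ((continuous_algebraMap ℂ (E →L[ℂ] E)).tendsto 0).comp
        (tendsto_one_div_add_atTop_nhds_zero_nat (𝕜 := ℂ))
    · rw [← IsUnit.neg_iff, neg_sub]
      refine spectrum.mem_resolventSet_of_spectralRadius_lt ?_
      rw [hzero]
      have : (1 / ((n : ℂ) + 1)) ≠ 0 := one_div_ne_zero (Nat.cast_add_one_ne_zero n)
      simpa using! this
  · refine ⟨μ, hr, fun hs => hμ ?_⟩
    rw [spectrum.mem_resolventSet_iff, ← IsUnit.neg_iff, neg_sub]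
    refine isUnit_of_surjective_of_tendsto
      (B := fun n => T - algebraMap ℂ (E →L[ℂ] E) ((1 + 1 / ((n : ℂ) + 1)) * μ))
      (by simpa [Algebra.algebraMap_eq_smul_one] using! hs) ?_ fun n => ?_
    · refine tendsto_const_nhds.sub ?_
      refine ((continuous_algebraMap ℂ (E →L[ℂ] E)).tendsto μ).comp ?_
      simpa using ((tendsto_one_div_add_atTop_nhds_zero_nat (𝕜 := ℂ)).const_add 1).mul_const μ
    · rw [← IsUnit.neg_iff, neg_sub]
      refine spectrum.mem_resolventSet_of_spectralRadius_lt ?_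
      rw [← hr, ENNReal.coe_lt_coe, ← NNReal.coe_lt_coe, coe_nnnorm, coe_nnnorm, norm_mul]
      have h1 : ‖(1 + 1 / ((n : ℂ) + 1))‖ = 1 + 1 / ((n : ℝ) + 1) := by
        have : (1 + 1 / ((n : ℂ) + 1)) = ((1 + 1 / ((n : ℝ) + 1) : ℝ) : ℂ) := by push_cast; rfl
        rw [this, Complex.norm_real, Real.norm_of_nonneg (by positivity)]
      rw [h1]
      have h2 : 0 < ‖μ‖ := norm_pos_iff.2 h0
      have h3 : 0 < 1 / ((n : ℝ) + 1) := by positivity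
      nlinarith

end SpectralRadius

/-! ### Root test for weighted series -/

section RootTest

theorem summable_of_limsup_root_lt {a : ℕ → ℝ} (ha : ∀ n, 0 ≤ a n) {ρ : ℝ}
    (h : limsup (fun n : ℕ => ENNReal.ofReal (a n ^ (1 / (n : ℝ)))) atTop < ENNReal.ofReal ρ) :
    Summable fun n => ρ⁻¹ ^ n * a n := by
  obtain ⟨ρ', hρ', h1, h2⟩ := ENNReal.lt_iff_exists_real_btwn.1 h
  have hρ : 0 < ρ := ENNReal.ofReal_pos.1 (bot_le.trans_lt h)
  have hlt : ρ' < ρ := (ENNReal.ofReal_lt_ofReal_iff hρ).1 h2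
  refine Summable.of_norm_bounded_eventually_nat (g := fun n => (ρ' / ρ) ^ n)
    (summable_geometric_of_lt_one (by positivity) ((div_lt_one hρ).2 hlt)) ?_
  filter_upwards [eventually_lt_of_limsup_lt h1, eventually_ge_atTop 1] with n hn hn1
  have hn0 : (n : ℝ) ≠ 0 := by positivity
  have h3 : a n ^ (1 / (n : ℝ)) ≤ ρ' := (ENNReal.lt_ofReal_iff_toReal_lt (by simp)).1 hn |>.le.trans'
    (by rw [ENNReal.toReal_ofReal (Real.rpow_nonneg (ha n) _)])
  have h4 : a n ≤ ρ' ^ n := by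
    have := pow_le_pow_left₀ (Real.rpow_nonneg (ha n) _) h3 n
    rwa [← Real.rpow_natCast, ← Real.rpow_mul (ha n), one_div_mul_cancel hn0, Real.rpow_one] at this
  rw [Real.norm_of_nonneg (mul_nonneg (by positivity) (ha n)), div_pow, inv_pow, div_eq_inv_mul]
  gcongr

theorem summable_of_lt_liminf_root {b : ℕ → ℝ} (hb : ∀ n, 0 < b n) {ρ : ℝ} (hρ : 0 ≤ ρ)
    (h : ENNReal.ofReal ρ < liminf (fun n : ℕ => ENNReal.ofReal (b n ^ (1 / (n : ℝ)))) atTop) :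
    Summable fun n => ρ ^ n * (b n)⁻¹ := by
  obtain ⟨ρ', hρ', h1, h2⟩ := ENNReal.lt_iff_exists_real_btwn.1 h
  have hpos : 0 < ρ' := ENNReal.ofReal_pos.1 (bot_le.trans_lt h1)
  have hlt : ρ < ρ' := (ENNReal.ofReal_lt_ofReal_iff hpos).1 h1
  refine Summable.of_norm_bounded_eventually_nat (g := fun n => (ρ / ρ') ^ n)
    (summable_geometric_of_lt_one (by positivity) ((div_lt_one hpos).2 hlt)) ?_
  filter_upwards [eventually_lt_of_lt_liminf h2, eventually_ge_atTop 1] with n hn hn1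
  have hn0 : (n : ℝ) ≠ 0 := by positivity
  have h3 : ρ' ≤ b n ^ (1 / (n : ℝ)) :=
    ((ENNReal.ofReal_lt_ofReal_iff (Real.rpow_pos_of_pos (hb n) _)).1 hn).le
  have h4 : ρ' ^ n ≤ b n := by
    have := pow_le_pow_left₀ hρ' h3 n
    rwa [← Real.rpow_natCast (b n ^ _), ← Real.rpow_mul (hb n).le, one_div_mul_cancel hn0,
      Real.rpow_one] at this
  rw [Real.norm_of_nonneg (mul_nonneg (by positivity) (inv_nonneg.2 (hb n).le)), div_pow,
    div_eq_mul_inv]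
  gcongr

/-- Summability of a one-sided weighted sequence does not depend on the starting index. -/
theorem summable_pow_mul_int_shift {a : ℤ → ℝ} {ρ : ℝ} (hρ : 0 < ρ)
    (h : Summable fun n : ℕ => ρ ^ n * a n) (k : ℤ) :
    Summable fun n : ℕ => ρ ^ n * a (n + k) := by
  obtain ⟨m, rfl | rfl⟩ := k.eq_nat_or_neg
  · have := ((summable_nat_add_iff m).2 h).mul_left (ρ ^ m)⁻¹
    refine this.congr fun n => ?_
    rw [pow_add]
    field_simp
    push_cast
    rfl
  · rw [← summable_nat_add_iff m]
    refine (h.mul_left (ρ ^ m)).congr fun n => ?_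
    rw [pow_add, Nat.cast_add, add_neg_cancel_right]
    ring

end RootTest

/-! ### The lower bound `m(T)` and `r₁` -/

section LowerBound

variable {H : Type*} [NormedAddCommGroup H] [InnerProductSpace ℂ H]

theorem lowerBound_mul_enorm_le (T : H →L[ℂ] H) (x : H) : lowerBound T * ‖x‖ₑ ≤ ‖T x‖ₑ := by
  by_cases hx : x = 0
  · simp [hx]
  have hn : ‖x‖ₑ ≠ 0 := enorm_ne_zero.2 hx
  have h1 : ‖((‖x‖⁻¹ : ℝ) : ℂ) • x‖ = 1 := by
    rw [norm_smul, Complex.norm_real, norm_inv, norm_norm, inv_mul_cancel₀ (norm_ne_zero_iff.2 hx)]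
  have h2 : lowerBound T ≤ ‖T (((‖x‖⁻¹ : ℝ) : ℂ) • x)‖ₑ :=
    iInf₂_le (f := fun (y : H) (_ : ‖y‖ = 1) => ‖T y‖ₑ) _ h1
  have h3 : ‖((‖x‖⁻¹ : ℝ) : ℂ)‖ₑ = ‖x‖ₑ⁻¹ := by
    rw [← enorm_norm x, ← enorm_inv (norm_ne_zero_iff.2 hx)]
    simp [enorm_eq_nnnorm, Complex.nnnorm_real]
  rw [map_smul, enorm_smul, h3] at h2
  calc lowerBound T * ‖x‖ₑ ≤ ‖x‖ₑ⁻¹ * ‖T x‖ₑ * ‖x‖ₑ := by gcongr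
    _ = ‖T x‖ₑ := by
      rw [mul_right_comm, ENNReal.inv_mul_cancel hn enorm_ne_top, one_mul]

theorem lowerBound_ne_top [Nontrivial H] (T : H →L[ℂ] H) : lowerBound T ≠ ⊤ := by
  obtain ⟨x, hx⟩ := exists_norm_eq H zero_le_one
  exact ne_top_of_le_ne_top enorm_ne_top (iInf₂_le x hx : lowerBound T ≤ ‖T x‖ₑ)

theorem lowerBound_unit [Nontrivial H] (u : (H →L[ℂ] H)ˣ) :
    lowerBound (u : H →L[ℂ] H) = ‖(↑u⁻¹ : H →L[ℂ] H)‖ₑ⁻¹ := by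
  have hinv : ∀ x, (↑u⁻¹ : H →L[ℂ] H) ((u : H →L[ℂ] H) x) = x := fun x => by
    rw [← mul_apply_eq_comp, Units.inv_mul, one_apply_eq_self]
  have hinv' : ∀ x, (u : H →L[ℂ] H) ((↑u⁻¹ : H →L[ℂ] H) x) = x := fun x => by
    rw [← mul_apply_eq_comp, Units.mul_inv, one_apply_eq_self]
  have hne : ‖(↑u⁻¹ : H →L[ℂ] H)‖ₑ ≠ 0 := by
    rw [enorm_eq_nnnorm, ENNReal.coe_ne_zero, nnnorm_ne_zero_iff]
    exact u⁻¹.ne_zero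
  refine le_antisymm ?_ (le_iInf₂ fun x hx => ?_)
  · rw [ENNReal.le_inv_iff_le_inv]
    by_cases h0 : lowerBound (u : H →L[ℂ] H) = 0
    · simp [h0]
    refine ContinuousLinearMap.opENorm_le_bound _ fun y => ?_
    have := lowerBound_mul_enorm_le (u : H →L[ℂ] H) ((↑u⁻¹ : H →L[ℂ] H) y)
    rw [hinv'] at this
    rwa [mul_comm, ← div_eq_mul_inv, ENNReal.le_div_iff_mul_le (.inl h0)
      (.inl (lowerBound_ne_top _)), mul_comm]
  · have h1 : ‖x‖ₑ = 1 := by rw [← enorm_norm, hx, enorm_one]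
    have := (↑u⁻¹ : H →L[ℂ] H).le_opENorm ((u : H →L[ℂ] H) x)
    rw [hinv, h1] at this
    rwa [ENNReal.inv_le_iff_le_mul (fun _ => hne) (fun h => absurd h enorm_ne_top)]

variable [CompleteSpace H]

/-- Being bounded below gives injectivity and closed range; density then makes the range everything.
-/
theorem isUnit_of_lowerBound_ne_zero [Nontrivial H] {T : H →L[ℂ] H}
    (hT : T.range.topologicalClosure = ⊤) (h : lowerBound T ≠ 0) : IsUnit T := by
  rw [ContinuousLinearMap.isUnit_iff_bijective,
    ContinuousLinearMap.bijective_iff_dense_range_and_antilipschitz]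
  refine ⟨hT, (lowerBound T).toNNReal⁻¹, T.antilipschitz_of_bound fun x => ?_⟩
  have hpos : 0 < (lowerBound T).toNNReal := ENNReal.toNNReal_pos h (lowerBound_ne_top T)
  have := lowerBound_mul_enorm_le T x
  rw [← ENNReal.coe_toNNReal (lowerBound_ne_top T), enorm_eq_nnnorm, enorm_eq_nnnorm,
    ← ENNReal.coe_mul, ENNReal.coe_le_coe, ← le_inv_mul_iff₀ hpos] at this
  exact_mod_cast this

theorem rOne_unit [Nontrivial H] (u : (H →L[ℂ] H)ˣ) :
    rOne (u : H →L[ℂ] H) = 1 / spectralRadius ℂ (↑u⁻¹ : H →L[ℂ] H) := by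
  have hterm : ∀ n : ℕ, lowerBound ((u : H →L[ℂ] H) ^ n) ^ (1 / (n : ℝ)) =
      ((‖(↑u⁻¹ : H →L[ℂ] H) ^ n‖₊ : ℝ≥0∞) ^ (1 / (n : ℝ)))⁻¹ := fun n => by
    rw [← Units.val_pow_eq_pow_val, lowerBound_unit, ENNReal.inv_rpow, ← inv_pow,
      Units.val_pow_eq_pow_val, enorm_eq_nnnorm]
  rw [one_div]
  refine le_antisymm (iSup₂_le fun n hn => ?_) ?_
  · rw [hterm, ENNReal.inv_le_inv]
    obtain ⟨m, rfl⟩ := Nat.exists_eq_add_of_le' hn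
    simpa using spectrum.spectralRadius_le_pow_nnnorm_pow_one_div ℂ (↑u⁻¹ : H →L[ℂ] H) m
  · refine le_of_tendsto
      (spectrum.pow_nnnorm_pow_one_div_tendsto_nhds_spectralRadius (↑u⁻¹ : H →L[ℂ] H)).inv ?_
    filter_upwards [eventually_ge_atTop 1] with n hn
    rw [← hterm]
    exact le_iSup₂ (f := fun (n : ℕ) (_ : 1 ≤ n) => lowerBound ((u : H →L[ℂ] H) ^ n) ^ (1 / (n : ℝ)))
      n hn

end LowerBound

/-! ### Weighted shifts and the comparison of radii -/

section WeightedShift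

theorem shiftBeta_zero (ω : ℤ → ℝ) : shiftBeta ω 0 = 1 := by simp [shiftBeta]

theorem shiftBeta_pos {ω : ℤ → ℝ} (hω : ∀ n, 0 < ω n) (n : ℤ) : 0 < shiftBeta ω n := by
  unfold shiftBeta
  split_ifs
  · exact Finset.prod_pos fun k _ => hω k
  · exact one_div_pos.2 (Finset.prod_pos fun k _ => hω k)

theorem shiftBeta_add_one {ω : ℤ → ℝ} (hω : ∀ n, 0 < ω n) (n : ℤ) :
    shiftBeta ω (n + 1) = ω n * shiftBeta ω n := by
  rcases le_or_gt 0 n with h | h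
  · rw [shiftBeta, shiftBeta, if_pos h, if_pos (by omega),
      ← Finset.insert_Ico_right_eq_Ico_add_one h, Finset.prod_insert (by simp)]
  · have hIco : Finset.Ico n 0 = insert n (Finset.Ico (n + 1) 0) :=
      (Finset.insert_Ico_add_one_left_eq_Ico h).symm
    have hn : shiftBeta ω n = 1 / (ω n * ∏ k ∈ Finset.Ico (n + 1) 0, ω k) := by
      rw [shiftBeta, if_neg (by omega), hIco, Finset.prod_insert (by simp)]
    have hn1 : shiftBeta ω (n + 1) = 1 / ∏ k ∈ Finset.Ico (n + 1) 0, ω k := by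
      rcases eq_or_lt_of_le (show n + 1 ≤ 0 by omega) with h1 | h1
      · simp [h1, shiftBeta_zero]
      · rw [shiftBeta, if_neg (by omega)]
    have := (hω n).ne'
    rw [hn, hn1]
    field_simp

variable {H : Type*} [NormedAddCommGroup H] [InnerProductSpace ℂ H]
  {e : HilbertBasis ℤ ℂ H} {ω : ℤ → ℝ} {S : H →L[ℂ] H}

/-- The rescaled basis `β n • e n`, on which the weighted shift acts as the plain shift. -/
noncomputable def rescaledBasis (e : HilbertBasis ℤ ℂ H) (ω : ℤ → ℝ) (n : ℤ) : H :=
  (shiftBeta ω n : ℂ) • e n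

theorem norm_rescaledBasis (e : HilbertBasis ℤ ℂ H) (hω : ∀ n, 0 < ω n) (n : ℤ) :
    ‖rescaledBasis e ω n‖ = shiftBeta ω n := by
  rw [rescaledBasis, norm_smul, e.orthonormal.1 n, mul_one, Complex.norm_real,
    Real.norm_of_nonneg (shiftBeta_pos hω n).le]

theorem basis_eq_smul_rescaledBasis (e : HilbertBasis ℤ ℂ H) (hω : ∀ n, 0 < ω n) (n : ℤ) :
    e n = (shiftBeta ω n : ℂ)⁻¹ • rescaledBasis e ω n := by
  rw [rescaledBasis, inv_smul_smul₀]
  exact_mod_cast (shiftBeta_pos hω n).ne'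

theorem basis_mem_analyticSpectralSubspace (hω : ∀ n, 0 < ω n) {n : ℤ} {F : Set ℂ}
    (h : Fᶜ ⊆ localResolventSet S (rescaledBasis e ω n)) :
    e n ∈ analyticSpectralSubspace S F := by
  rw [basis_eq_smul_rescaledBasis e hω n]
  exact (analyticSpectralSubmodule S F).smul_mem _ (mem_analyticSpectralSubspace_iff.2 h)

namespace IsBilateralWeightedShift

theorem apply_rescaledBasis (hS : IsBilateralWeightedShift e ω S) (n : ℤ) :
    S (rescaledBasis e ω n) = rescaledBasis e ω (n + 1) := by
  rw [rescaledBasis, rescaledBasis, map_smul, hS.apply_basis, shiftBeta_add_one hS.weight_pos,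
    smul_smul, Complex.ofReal_mul, mul_comm]

theorem pow_apply_rescaledBasis (hS : IsBilateralWeightedShift e ω S) (n : ℕ) (k : ℤ) :
    (S ^ n) (rescaledBasis e ω k) = rescaledBasis e ω (k + n) := by
  induction n with
  | zero => simp
  | succ n ih =>
    rw [pow_succ', mul_apply_eq_comp, ih, hS.apply_rescaledBasis]
    congr 1
    push_cast
    ring

theorem repr_apply_add_one (hS : IsBilateralWeightedShift e ω S) (x : H) (n : ℤ) :
    e.repr (S x) (n + 1) = ω n * e.repr x n := by
  have hx : HasSum (fun i => inner ℂ (e (n + 1)) (S (e.repr x i • e i)))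
      (inner ℂ (e (n + 1)) (S x)) :=
    ((innerSL ℂ (e (n + 1))).comp S).hasSum (e.hasSum_repr x)
  have hsingle : HasSum (fun i => inner ℂ (e (n + 1)) (S (e.repr x i • e i)))
      (ω n * e.repr x n) := by
    have horth := orthonormal_iff_ite.1 e.orthonormal
    convert hasSum_single n fun i hi => ?_ using 1
    · rw [map_smul, hS.apply_basis, inner_smul_right, inner_smul_right, horth, if_pos rfl]
      ring
    · rw [map_smul, hS.apply_basis, inner_smul_right, inner_smul_right, horth, if_neg (by omega)]
      ring
  rw [e.repr_apply_apply]
  exact hx.unique hsingle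

theorem injective (hS : IsBilateralWeightedShift e ω S) : Function.Injective S := by
  rw [injective_iff_map_eq_zero]
  intro x hx
  refine (map_eq_zero_iff e.repr e.repr.injective).1 (lp.ext (funext fun n => ?_))
  have := hS.repr_apply_add_one x n
  rw [hx, map_zero] at this
  exact (mul_eq_zero.1 this.symm).resolve_left (Complex.ofReal_ne_zero.2 (hS.weight_pos n).ne')

theorem topologicalClosure_range_pow (hS : IsBilateralWeightedShift e ω S) (n : ℕ) :
    (S ^ n).range.topologicalClosure = ⊤ := by
  rw [eq_top_iff, ← e.dense_span]
  refine Submodule.topologicalClosure_mono (Submodule.span_le.2 ?_)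
  rintro _ ⟨k, rfl⟩
  rw [basis_eq_smul_rescaledBasis e hS.weight_pos k]
  refine Submodule.smul_mem _ _ ⟨rescaledBasis e ω (k - n), ?_⟩
  exact (hS.pow_apply_rescaledBasis n (k - n)).trans (by rw [sub_add_cancel])

theorem inv_pow_apply_rescaledBasis {u : (H →L[ℂ] H)ˣ}
    (hS : IsBilateralWeightedShift e ω (u : H →L[ℂ] H)) (n : ℕ) :
    ((↑u⁻¹ : H →L[ℂ] H) ^ n) (rescaledBasis e ω 0) = rescaledBasis e ω (-n) := by
  have h := hS.pow_apply_rescaledBasis n (-n)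
  rw [neg_add_cancel] at h
  rw [← h, ← Units.val_pow_eq_pow_val, ← Units.val_pow_eq_pow_val, ← mul_apply_eq_comp,
    ← Units.val_mul, inv_pow, inv_mul_cancel, Units.val_one, one_apply_eq_self]

variable [CompleteSpace H]

theorem surjective_sub_smul_of_rThreePlus_lt (hS : IsBilateralWeightedShift e ω S)
    (hC : DunfordConditionC S) {μ : ℂ} (hμ : rThreePlus ω < ‖μ‖₊) :
    Function.Surjective (S - μ • ContinuousLinearMap.id ℂ H) := by
  obtain ⟨ρ, -, h1, h2⟩ := ENNReal.lt_iff_exists_real_btwn.1 hμ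
  have hρ : 0 < ρ := ENNReal.ofReal_pos.1 (bot_le.trans_lt h1)
  rw [← enorm_eq_nnnorm, ← ofReal_norm,
    ENNReal.ofReal_lt_ofReal_iff_of_nonneg hρ.le] at h2
  have hsum := summable_of_limsup_root_lt (fun n => (shiftBeta_pos hS.weight_pos n).le) h1
  have hF : {z : ℂ | ‖z‖ ≤ ρ}ᶜ = {z : ℂ | ρ < ‖z‖} := by ext; simp
  refine hC.surjective_sub_smul (F := {z | ‖z‖ ≤ ρ}) (isClosed_le continuous_norm continuous_const)
    e (fun k => basis_mem_analyticSpectralSubspace hS.weight_pos ?_) (not_le.2 h2)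
  rw [hF]
  have hv := exterior_subset_localResolventSet (T := S)
    (v := fun n : ℕ => rescaledBasis e ω (n + k)) hρ (fun n => ?_) ?_
  · simpa using hv
  · rw [hS.apply_rescaledBasis]
    congr 1
    push_cast
    ring
  · simp only [norm_rescaledBasis e hS.weight_pos]
    exact summable_pow_mul_int_shift (a := shiftBeta ω) (inv_pos.2 hρ) hsum k

theorem surjective_sub_smul_of_lt_rTwoMinus (hS : IsBilateralWeightedShift e ω S)
    (hC : DunfordConditionC S) {μ : ℂ} (hμ : (‖μ‖₊ : ℝ≥0∞) < rTwoMinus ω) :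
    Function.Surjective (S - μ • ContinuousLinearMap.id ℂ H) := by
  obtain ⟨ρ, hρ0, h1, h2⟩ := ENNReal.lt_iff_exists_real_btwn.1 hμ
  have hρ : 0 < ρ := ENNReal.ofReal_pos.1 (bot_le.trans_lt h1)
  rw [← enorm_eq_nnnorm, ← ofReal_norm, ENNReal.ofReal_lt_ofReal_iff hρ] at h1
  have hsum := summable_of_lt_liminf_root
    (fun n => one_div_pos.2 (shiftBeta_pos hS.weight_pos (-(n : ℤ)))) hρ0 h2
  simp only [one_div, inv_inv] at hsum
  have hF : {z : ℂ | ρ ≤ ‖z‖}ᶜ = {z : ℂ | ‖z‖ < ρ} := by ext; simp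
  refine hC.surjective_sub_smul (F := {z | ρ ≤ ‖z‖}) (isClosed_le continuous_const continuous_norm)
    e (fun k => basis_mem_analyticSpectralSubspace hS.weight_pos ?_) (not_le.2 h1)
  rw [hF]
  refine ball_subset_localResolventSet
    -- The backward orbit starts at index `k - 1`, one step before the target vector.
    (v := fun n : ℕ => rescaledBasis e ω (-(n + (1 - k)))) ?_ (fun n => ?_) ?_
  · rw [hS.apply_rescaledBasis]
    congr 1
    push_cast
    ring
  · rw [hS.apply_rescaledBasis]
    congr 1
    push_cast
    ring
  · simp only [norm_rescaledBasis e hS.weight_pos]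
    exact summable_pow_mul_int_shift (a := fun n => shiftBeta ω (-n)) hρ hsum (1 - k)

theorem rThreePlus_eq_spectralRadius [Nontrivial H] (hS : IsBilateralWeightedShift e ω S)
    (hC : DunfordConditionC S) : rThreePlus ω = spectralRadius ℂ S := by
  refine le_antisymm ?_ ?_
  · rw [← (spectrum.pow_nnnorm_pow_one_div_tendsto_nhds_spectralRadius S).limsup_eq]
    refine limsup_le_limsup (.of_forall fun n => ?_)
    have hβ := shiftBeta_pos hS.weight_pos
    beta_reduce
    rw [← ENNReal.ofReal_rpow_of_pos (hβ n), ← enorm_eq_nnnorm, ← ofReal_norm]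
    refine ENNReal.rpow_le_rpow (ENNReal.ofReal_le_ofReal ?_) (by positivity)
    have := (S ^ n).le_opNorm (rescaledBasis e ω 0)
    rwa [hS.pow_apply_rescaledBasis, zero_add, norm_rescaledBasis e hS.weight_pos,
      norm_rescaledBasis e hS.weight_pos, shiftBeta_zero, mul_one] at this
  · obtain ⟨μ, hμ, hns⟩ := exists_nnnorm_eq_spectralRadius_not_surjective S
    rw [← hμ]
    exact not_lt.1 fun h => hns (hS.surjective_sub_smul_of_rThreePlus_lt hC h)

theorem rTwoMinus_eq_zero (hS : IsBilateralWeightedShift e ω S) (hC : DunfordConditionC S)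
    (hu : ¬ IsUnit S) : rTwoMinus ω = 0 := by
  by_contra h
  have := hS.surjective_sub_smul_of_lt_rTwoMinus hC (μ := 0) (by simpa [pos_iff_ne_zero] using h)
  rw [zero_smul, sub_zero] at this
  exact hu (ContinuousLinearMap.isUnit_iff_bijective.2 ⟨hS.injective, this⟩)

theorem rOne_eq_zero [Nontrivial H] (hS : IsBilateralWeightedShift e ω S) (hu : ¬ IsUnit S) :
    rOne S = 0 := by
  refine le_bot_iff.1 (iSup₂_le fun n hn => ?_)
  have h0 : lowerBound (S ^ n) = 0 := by
    by_contra h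
    have := isUnit_of_lowerBound_ne_zero (hS.topologicalClosure_range_pow n) h
    exact hu ((isUnit_pow_iff (by omega)).1 this)
  rw [h0, ENNReal.zero_rpow_of_pos (by positivity)]
  rfl

/-- For `μ ≠ 0`, `S⁻¹ - μ = -μ S⁻¹ (S - μ⁻¹)`, so surjectivity of `S - μ⁻¹` for `|μ⁻¹| < r₂⁻` passes
to `S⁻¹ - μ`. -/
theorem inv_spectralRadius_inv_eq_rTwoMinus [Nontrivial H] {u : (H →L[ℂ] H)ˣ}
    (hS : IsBilateralWeightedShift e ω (u : H →L[ℂ] H)) (hC : DunfordConditionC (u : H →L[ℂ] H)) :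
    1 / spectralRadius ℂ (↑u⁻¹ : H →L[ℂ] H) = rTwoMinus ω := by
  rw [one_div]
  refine le_antisymm ?_ ?_
  · rw [← (spectrum.pow_nnnorm_pow_one_div_tendsto_nhds_spectralRadius
      (↑u⁻¹ : H →L[ℂ] H)).inv.liminf_eq]
    refine liminf_le_liminf (.of_forall fun n => ?_)
    have hβ := shiftBeta_pos hS.weight_pos
    rw [one_div (shiftBeta _ _), ← ENNReal.ofReal_rpow_of_pos (inv_pos.2 (hβ _)),
      ENNReal.ofReal_inv_of_pos (hβ _), ENNReal.inv_rpow, ENNReal.inv_le_inv,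
      ← enorm_eq_nnnorm, ← ofReal_norm]
    refine ENNReal.rpow_le_rpow (ENNReal.ofReal_le_ofReal ?_) (by positivity)
    have := ((↑u⁻¹ : H →L[ℂ] H) ^ n).le_opNorm (rescaledBasis e ω 0)
    rwa [hS.inv_pow_apply_rescaledBasis, norm_rescaledBasis e hS.weight_pos,
      norm_rescaledBasis e hS.weight_pos, shiftBeta_zero, mul_one] at this
  · obtain ⟨μ, hμ, hns⟩ := exists_nnnorm_eq_spectralRadius_not_surjective (↑u⁻¹ : H →L[ℂ] H)
    rw [← hμ]
    refine not_lt.1 fun h => hns ?_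
    have hbij := ContinuousLinearMap.isUnit_iff_bijective.1 u⁻¹.isUnit
    by_cases h0 : μ = 0
    · simpa [h0] using hbij.2
    have hs := hS.surjective_sub_smul_of_lt_rTwoMinus hC (μ := μ⁻¹) (by
      rwa [nnnorm_inv, ENNReal.coe_inv (nnnorm_ne_zero_iff.2 h0)])
    intro y
    -- The target is chosen so that applying `-μ S⁻¹` returns `y`.
    obtain ⟨x, hx⟩ := hs ((u : H →L[ℂ] H) (-μ⁻¹ • y))
    refine ⟨x, ?_⟩
    have hinv : ∀ z, (↑u⁻¹ : H →L[ℂ] H) ((u : H →L[ℂ] H) z) = z := fun z => by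
      rw [← mul_apply_eq_comp, Units.inv_mul, one_apply_eq_self]
    have h1 := congrArg (fun z => -μ • (↑u⁻¹ : H →L[ℂ] H) z) hx
    simp only [sub_apply, map_sub, hinv, smul_apply, map_smul, ContinuousLinearMap.id_apply,
      smul_sub, smul_smul] at h1
    simpa [h0, sub_eq_add_neg, add_comm] using h1

end IsBilateralWeightedShift

/-- Any spectral point `μ` of `u` satisfies `1 / r(u⁻¹) ≤ |μ| ≤ r(u)`, since `μ⁻¹` lies in the
spectrum of `u⁻¹`. -/
theorem inv_spectralRadius_inv_le_spectralRadius {A : Type*} [NormedRing A] [NormedAlgebra ℂ A]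
    [CompleteSpace A] [Nontrivial A] (u : Aˣ) :
    1 / spectralRadius ℂ (↑u⁻¹ : A) ≤ spectralRadius ℂ (u : A) := by
  obtain ⟨μ, hμ⟩ := spectrum.nonempty (u : A)
  have hμ0 : μ ≠ 0 := spectrum.ne_zero_of_mem_of_unit hμ
  have hinv : μ⁻¹ ∈ spectrum ℂ (↑u⁻¹ : A) := by
    have := spectrum.inv_mem_iff (r := Units.mk0 μ hμ0) (a := u)
    simpa using this.1 hμ
  have h1 : ((‖μ‖₊ : ℝ≥0∞))⁻¹ ≤ spectralRadius ℂ (↑u⁻¹ : A) := by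
    rw [← ENNReal.coe_inv (nnnorm_ne_zero_iff.2 hμ0), ← nnnorm_inv]
    exact le_iSup₂ (f := fun k (_ : k ∈ spectrum ℂ (↑u⁻¹ : A)) => (‖k‖₊ : ℝ≥0∞)) _ hinv
  rw [one_div]
  exact (ENNReal.inv_le_iff_inv_le.1 h1).trans
    (le_iSup₂ (f := fun k (_ : k ∈ spectrum ℂ (u : A)) => (‖k‖₊ : ℝ≥0∞)) _ hμ)

end WeightedShift

theorem theorem4 {H : Type*} [NormedAddCommGroup H] [InnerProductSpace ℂ H] [CompleteSpace H]
    (e : HilbertBasis ℤ ℂ H) (ω : ℤ → ℝ) (S : H →L[ℂ] H)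
    (hS : IsBilateralWeightedShift e ω S) (hC : DunfordConditionC S) :
    (¬ IsUnit S →
      rOne S = rTwoMinus ω ∧ rTwoMinus ω = 0 ∧ 0 ≤ rThreePlus ω ∧
        rThreePlus ω = spectralRadius ℂ S) ∧
    (∀ hu : IsUnit S,
      rOne S = 1 / spectralRadius ℂ (↑hu.unit⁻¹ : H →L[ℂ] H) ∧
        1 / spectralRadius ℂ (↑hu.unit⁻¹ : H →L[ℂ] H) = rTwoMinus ω ∧
        rTwoMinus ω ≤ rThreePlus ω ∧ rThreePlus ω = spectralRadius ℂ S) := by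
  have : Nontrivial H := ⟨e 0, 0, e.orthonormal.ne_zero 0⟩
  have h3 := hS.rThreePlus_eq_spectralRadius hC
  refine ⟨fun hu => ?_, fun hu => ?_⟩
  · have h2 := hS.rTwoMinus_eq_zero hC hu
    exact ⟨(hS.rOne_eq_zero hu).trans h2.symm, h2, zero_le, h3⟩
  · obtain ⟨u, rfl⟩ := hu
    have hunit : (Units.isUnit u).unit = u := Units.ext rfl
    rw [hunit]
    have h2 := hS.inv_spectralRadius_inv_eq_rTwoMinus hC
    refine ⟨rOne_unit u, h2, ?_, h3⟩
    rw [h3, ← h2]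
    exact inv_spectralRadius_inv_le_spectralRadius u
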